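/- Let $H$ be a finite-dimensional complex Hilbert space and let $\mathcal E_0,\mathcal E_1$ be quantum operations on $\mathcal B(H)$, i.e. maps $\rho\mapsto\sum_{i=1}^m E_i\rho E_i^\dagger$ with $\sum_{i=1}^m E_i^\dagger E_i=I$; let $\mathcal I$ be the identity operation. The support of a density operator is the span of its eigenvectors with positive eigenvalue. For density operators $\rho_0,\rho_1$ put $$\tilde F(\rho_0,\rho_1)=\max\{|\langle\psi_0|\psi_1\rangle| : \psi_k\in\operatorname{supp}(\rho_k),\ \|\psi_k\|=1,\ k=0,1\},$$ and for an operation $\mathcal E$ put $$\tilde F_1(\mathcal E,\mathcal I)=\min\{\tilde F(\mathcal E(|\psi_0\rangle\langle\psi_0|),|\psi_1\rangle\langle\psi_1|) : \|\psi_0\|=\|\psi_1\|=1,\ \langle\psi_0|\psi_1\rangle=1\}.$$ In a sequential scheme with $N$ queries to an unknown operation $\mathcal E\in\{\mathcal E_0,\mathcal E_1\}$, no auxiliary system is used: one prepares a density operator $\rho$ on $H$, applies $\mathcal E$ to it $N$ times, applying between the $k$-th and the $(k+1)$-th query a known quantum operation $\mathcal T_k$ on $\mathcal B(H)$ for $1\le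 k\le N-1$, and finally performs a two-outcome measurement $\{M_0,M_1\}$, $M_0,M_1\ge 0$, $M_0+M_1=I$. With $\sigma_k$ denoting the final state when $\mathcal E=\mathcal E_k$, the scheme distinguishes $\mathcal E_0$ and $\mathcal E_1$ perfectly if $\operatorname{tr}(M_1\sigma_0)=\operatorname{tr}(M_0\sigma_1)=0$. The operations are sequentially perfectly distinguishable if such a scheme exists for some finite $N$, and $N_{\min}$ is then the least such $N$. If $\mathcal E_0$ and $\mathcal E_1$ are sequentially perfectly distinguishable, then $\arccos\tilde F_1(\mathcal E_0,\mathcal I)+\arccos\tilde F_1(\mathcal E_1,\mathcal I)>0$ and $$N_{\min}\ \ge\ \left\lceil\frac{\pi}{2\bigl(\arccos\tilde F_1(\mathcal E_0,\mathcal I)+\arccos\tilde F_1(\mathcal E_1,\mathcal I)\bigr)}\right\rceil .$$ -/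

import Mathlib

namespace QuantumDiscrimination

section

variable {H : Type*} [NormedAddCommGroup H] [InnerProductSpace ℂ H] [FiniteDimensional ℂ H]

/-- A density operator (quantum state): a positive operator of trace one. -/
def IsDensityOperator (ρ : H →ₗ[ℂ] H) : Prop :=
  ρ.IsPositive ∧ LinearMap.trace ℂ H ρ = 1

/-- The operator `|ψ⟩⟨ψ|`. -/
noncomputable def pureState (ψ : H) : H →ₗ[ℂ] H :=
  (InnerProductSpace.rankOne ℂ ψ ψ).toLinearMap

/-- The support of a positive operator: the span of its eigenvectors with positive eigenvalue. -/
def support (ρ : H →ₗ[ℂ] H) : Submodule ℂ H :=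
  Submodule.span ℂ {v : H | ∃ p : ℝ, 0 < p ∧ ρ v = (p : ℂ) • v}

variable (H) in
/-- A quantum operation on `B(H)`: a map of the form `ρ ↦ ∑ i, Kᵢ ρ Kᵢ†` for finitely many
operators `Kᵢ` (Kraus operators) with `∑ i, Kᵢ† Kᵢ = 1`. -/
structure QuantumOperation where
  toFun : (H →ₗ[ℂ] H) → (H →ₗ[ℂ] H)
  exists_kraus : ∃ (m : ℕ) (K : Fin m → (H →ₗ[ℂ] H)),
    (∑ i, LinearMap.adjoint (K i) ∘ₗ K i) = LinearMap.id ∧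
    ∀ ρ : H →ₗ[ℂ] H, toFun ρ = ∑ i, K i ∘ₗ ρ ∘ₗ LinearMap.adjoint (K i)

instance : CoeFun (QuantumOperation H) (fun _ => (H →ₗ[ℂ] H) → (H →ₗ[ℂ] H)) where
  coe E := E.toFun

variable (H) in
/-- The identity operation. -/
def identityOperation : QuantumOperation H where
  toFun ρ := ρ
  exists_kraus := by
    refine ⟨1, fun _ => LinearMap.id, ?_, fun ρ => ?_⟩ <;> ext v <;>
      simp [← Module.End.one_eq_id]

/-- The maximal fidelity of two states: the maximum of `|⟨ψ₀|ψ₁⟩|` over unit vectors `ψ₀`, `ψ₁` in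
the respective supports. -/
noncomputable def maximalFidelity (ρ₀ ρ₁ : H →ₗ[ℂ] H) : ℝ :=
  sSup {t : ℝ | ∃ ψ₀ ∈ support ρ₀, ∃ ψ₁ ∈ support ρ₁,
    ‖ψ₀‖ = 1 ∧ ‖ψ₁‖ = 1 ∧ t = ‖inner ℂ ψ₀ ψ₁‖}

/-- The `q`-maximal fidelity of two operations: the minimum of the maximal fidelity of the outputs
over pairs of pure input states with `⟨ψ₀|ψ₁⟩ = q`. -/
noncomputable def qMaximalFidelity (q : ℝ) (E₀ E₁ : QuantumOperation H) : ℝ :=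
  sInf {t : ℝ | ∃ ψ₀ ψ₁ : H, ‖ψ₀‖ = 1 ∧ ‖ψ₁‖ = 1 ∧ inner ℂ ψ₀ ψ₁ = (q : ℂ) ∧
    t = maximalFidelity (E₀ (pureState ψ₀)) (E₁ (pureState ψ₁))}

/-- The state after `N` queries to the operation `E` in the sequential scheme with input state `ρ`
and known intermediate operations `T 0, T 1, …`, where `T k` is applied to the output of query
number `k + 1` and gives the input of query number `k + 2`. No auxiliary system is used. -/
def sequentialOutput (E : QuantumOperation H) (ρ : H →ₗ[ℂ] H) (T : ℕ → QuantumOperation H) :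
    ℕ → (H →ₗ[ℂ] H)
  | 0 => ρ
  | 1 => E ρ
  | n + 2 => E (T n (sequentialOutput E ρ T (n + 1)))

/-- Two states are perfectly distinguishable if some two-outcome measurement `{M₀, M₁}` identifies
them without error. -/
def StatesPerfectlyDistinguishable (σ₀ σ₁ : H →ₗ[ℂ] H) : Prop :=
  ∃ M₀ M₁ : H →ₗ[ℂ] H, M₀.IsPositive ∧ M₁.IsPositive ∧ M₀ + M₁ = LinearMap.id ∧
    LinearMap.trace ℂ H (M₁ ∘ₗ σ₀) = 0 ∧ LinearMap.trace ℂ H (M₀ ∘ₗ σ₁) = 0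

/-- Some sequential scheme with `N` queries distinguishes the two operations perfectly. -/
def SequentiallyDistinguishableIn (E₀ E₁ : QuantumOperation H) (N : ℕ) : Prop :=
  ∃ (ρ : H →ₗ[ℂ] H) (T : ℕ → QuantumOperation H), IsDensityOperator ρ ∧
    StatesPerfectlyDistinguishable (sequentialOutput E₀ ρ T N) (sequentialOutput E₁ ρ T N)

/-- The two operations are sequentially perfectly distinguishable: finitely many queries suffice. -/
def SequentiallyPerfectlyDistinguishable (E₀ E₁ : QuantumOperation H) : Prop :=
  ∃ N : ℕ, SequentiallyDistinguishableIn E₀ E₁ N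

/-- The optimal query number: the least number of queries of a perfectly distinguishing sequential
scheme. -/
noncomputable def optimalSequentialQueryNumber (E₀ E₁ : QuantumOperation H) : ℕ :=
  sInf {N : ℕ | SequentiallyDistinguishableIn E₀ E₁ N}

end

end QuantumDiscrimination

namespace QuantumDiscrimination

section PureStates

variable {H : Type*} [NormedAddCommGroup H] [InnerProductSpace ℂ H]

/-! Follow one unit vector in the support of each of the two evolving states and measure the angle
`arccos |⟨φ₀|φ₁⟩|` between their rays, which satisfies the triangle inequality. The vectors start
equal, at angle 0. A query to `E` can be followed by a vector moving at most `arccos F̃₁(E, I)`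
(`exists_unit_mem_support_rayAngle_le`), so one round of queries widens the angle by at most the sum
`S` of the two arccosines. An intermediate operation need not widen it: some Kraus operator
preserves the overlap after normalization (`exists_unit_mem_support_apply_norm_inner_ge`). Perfect
discrimination makes the supports orthogonal, that is, puts the angle at `π / 2`. Hence `π / 2 ≤ N *
S`, which gives both claims. -/

lemma isPositive_pureState (ψ : H) : (pureState ψ).IsPositive :=
  InnerProductSpace.isPositive_rankOne_self ψ

lemma mem_support_pureState (ψ : H) : ψ ∈ support (pureState ψ) := by
  rcases eq_or_ne ψ 0 with rfl | h
  · exact Submodule.zero_mem _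
  · refine Submodule.subset_span ⟨‖ψ‖ ^ 2, by positivity, ?_⟩
    simp [pureState]

lemma maximalFidelity_nonneg (ρ₀ ρ₁ : H →ₗ[ℂ] H) : 0 ≤ maximalFidelity ρ₀ ρ₁ := by
  refine Real.sSup_nonneg ?_
  rintro t ⟨ψ₀, -, ψ₁, -, -, -, rfl⟩
  exact norm_nonneg _

end PureStates

open scoped ComplexOrder

/-! ### Positive operators: supports, vanishing traces and orthogonality -/

section PositiveOperators

variable {H : Type*} [NormedAddCommGroup H] [InnerProductSpace ℂ H] [FiniteDimensional ℂ H]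

/-- A positive operator kills every vector at which its quadratic form vanishes. -/
lemma apply_eq_zero_of_inner_self_eq_zero {M : H →ₗ[ℂ] H} (hM : M.IsPositive) {x : H}
    (hx : inner ℂ x (M x) = 0) : M x = 0 := by
  have hM' := M.isPositive_toContinuousLinearMap_iff.mpr hM
  -- Writing `M` as a sum of `|uᵢ⟩⟨uᵢ|` turns the quadratic form into a sum of squares.
  obtain ⟨m, u, hu⟩ := ContinuousLinearMap.isPositive_iff_eq_sum_rankOne.mp hM'
  have happ : ∀ y, M y = ∑ i, inner ℂ (u i) y • u i := fun y => by
    have := congrArg (fun f : H →L[ℂ] H => f y) hu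
    simpa using this
  have hsum : ∑ i, ‖inner ℂ (u i) x‖ ^ 2 = 0 := by
    rw [happ, inner_sum] at hx
    have : ∀ i, inner ℂ x (inner ℂ (u i) x • u i) = ((‖inner ℂ (u i) x‖ ^ 2 : ℝ) : ℂ) := by
      intro i
      rw [inner_smul_right, ← inner_conj_symm x (u i), Complex.mul_conj']
      push_cast
      rfl
    simp_rw [this] at hx
    exact_mod_cast hx
  rw [Finset.sum_eq_zero_iff_of_nonneg (fun _ _ => by positivity)] at hsum
  rw [happ]
  refine Finset.sum_eq_zero fun i hi => ?_
  have := hsum i hi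
  simp only [ne_eq, OfNat.ofNat_ne_zero, not_false_eq_true, pow_eq_zero_iff, norm_eq_zero] at this
  rw [this, zero_smul]

/-- The support of a positive operator is its range. -/
lemma support_eq_range {ρ : H →ₗ[ℂ] H} (hρ : ρ.IsPositive) : support ρ = LinearMap.range ρ := by
  apply le_antisymm
  · refine Submodule.span_le.mpr ?_
    rintro v ⟨p, hp, hv⟩
    refine ⟨(p : ℂ)⁻¹ • v, ?_⟩
    rw [map_smul, hv, inv_smul_smul₀]
    exact_mod_cast hp.ne'
  · rintro _ ⟨v, rfl⟩
    have hs := hρ.isSymmetric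
    set b := hs.eigenvectorBasis rfl
    rw [← b.sum_repr v, map_sum]
    refine Submodule.sum_mem _ fun i _ => ?_
    rw [map_smul]
    refine Submodule.smul_mem _ _ ?_
    have hb : ρ (b i) = (hs.eigenvalues rfl i : ℂ) • b i := hs.apply_eigenvectorBasis rfl i
    rcases (hρ.nonneg_eigenvalues rfl i).eq_or_lt with h | h
    · rw [hb, ← h]
      simp
    · rw [hb]
      exact Submodule.smul_mem _ _ (Submodule.subset_span ⟨_, h, hb⟩)

/-- If `tr (M σ) = 0` for positive operators `M`, `σ`, then `M` vanishes on the support of `σ`. -/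
lemma apply_eq_zero_of_trace_comp_eq_zero {M σ : H →ₗ[ℂ] H} (hM : M.IsPositive)
    (hσ : σ.IsPositive) (htr : LinearMap.trace ℂ H (M ∘ₗ σ) = 0) {v : H} (hv : v ∈ support σ) :
    M v = 0 := by
  have hs := hσ.isSymmetric
  set b := hs.eigenvectorBasis rfl
  have hb : ∀ i, σ (b i) = (hs.eigenvalues rfl i : ℂ) • b i :=
    fun i => hs.apply_eigenvectorBasis rfl i
  rw [LinearMap.trace_eq_sum_inner _ b] at htr
  have hterm : ∀ i, 0 ≤ inner ℂ (b i) ((M ∘ₗ σ) (b i)) := fun i => by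
    rw [LinearMap.comp_apply, hb, map_smul, inner_smul_right]
    exact mul_nonneg (by exact_mod_cast hσ.nonneg_eigenvalues rfl i) (hM.inner_nonneg_right _)
  rw [Finset.sum_eq_zero_iff_of_nonneg (fun i _ => hterm i)] at htr
  have hzero : M ∘ₗ σ = 0 := by
    refine b.toBasis.ext fun i => ?_
    have h := htr i (Finset.mem_univ i)
    rw [LinearMap.comp_apply, hb, map_smul, inner_smul_right, mul_eq_zero] at h
    rw [b.coe_toBasis, LinearMap.comp_apply, hb, map_smul, LinearMap.zero_apply]
    rcases h with h | h
    · rw [h, zero_smul]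
    · rw [apply_eq_zero_of_inner_self_eq_zero hM h, smul_zero]
  rw [support_eq_range hσ] at hv
  obtain ⟨u, rfl⟩ := hv
  exact LinearMap.congr_fun hzero u

/-- The supports of two perfectly distinguishable states are orthogonal. -/
lemma StatesPerfectlyDistinguishable.inner_eq_zero {σ₀ σ₁ : H →ₗ[ℂ] H}
    (h : StatesPerfectlyDistinguishable σ₀ σ₁) (h₀ : σ₀.IsPositive) (h₁ : σ₁.IsPositive)
    {φ₀ φ₁ : H} (hφ₀ : φ₀ ∈ support σ₀) (hφ₁ : φ₁ ∈ support σ₁) : inner ℂ φ₀ φ₁ = 0 := by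
  obtain ⟨M₀, M₁, hM₀, hM₁, hsum, ht₀, ht₁⟩ := h
  have e₀ := apply_eq_zero_of_trace_comp_eq_zero hM₁ h₀ ht₀ hφ₀
  have e₁ := apply_eq_zero_of_trace_comp_eq_zero hM₀ h₁ ht₁ hφ₁
  have e : φ₁ = M₁ φ₁ := by
    have := LinearMap.congr_fun hsum φ₁
    simpa [e₁] using this.symm
  rw [e, ← hM₁.isSymmetric, e₀, inner_zero_left]

lemma IsDensityOperator.exists_unit_mem_support {ρ : H →ₗ[ℂ] H} (h : IsDensityOperator ρ) :
    ∃ φ ∈ support ρ, ‖φ‖ = 1 := by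
  have hne : ρ ≠ 0 := by
    rintro rfl
    simpa using h.2
  obtain ⟨v, hv⟩ : ∃ v, ρ v ≠ 0 := by
    by_contra! hc
    exact hne (LinearMap.ext hc)
  refine ⟨((‖ρ v‖ : ℂ)⁻¹) • ρ v, Submodule.smul_mem _ _ ?_, ?_⟩
  · rw [support_eq_range h.1]
    exact ⟨v, rfl⟩
  · exact norm_smul_inv_norm hv

end PositiveOperators

/-! ### Kraus operators acting on supports -/

section Operations

variable {H : Type*} [NormedAddCommGroup H] [InnerProductSpace ℂ H] [FiniteDimensional ℂ H]

lemma QuantumOperation.isPositive_apply (E : QuantumOperation H) {σ : H →ₗ[ℂ] H}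
    (hσ : σ.IsPositive) : (E σ).IsPositive := by
  obtain ⟨m, K, -, hE⟩ := E.exists_kraus
  rw [hE]
  exact LinearMap.isPositive_sum _ fun i _ => hσ.conj_adjoint (K i)

/-- Kraus operators map the support of a state into the support of the output. -/
lemma kraus_apply_mem_support {m : ℕ} (K : Fin m → (H →ₗ[ℂ] H)) {σ : H →ₗ[ℂ] H}
    (hσ : σ.IsPositive) {v : H} (hv : v ∈ support σ) (i : Fin m) :
    K i v ∈ support (∑ j, K j ∘ₗ σ ∘ₗ LinearMap.adjoint (K j)) := by
  have hpos : (∑ j, K j ∘ₗ σ ∘ₗ LinearMap.adjoint (K j)).IsPositive :=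
    LinearMap.isPositive_sum _ fun i _ => hσ.conj_adjoint (K i)
  set R := ∑ j, K j ∘ₗ σ ∘ₗ LinearMap.adjoint (K j) with hR
  -- The range of the self-adjoint `R` is the orthogonal complement of its kernel, so it suffices
  -- that `K i v` is orthogonal to `ker R`.
  rw [support_eq_range hpos, ← Submodule.orthogonal_orthogonal (LinearMap.range R),
    hpos.isSymmetric.orthogonal_range, Submodule.mem_orthogonal]
  intro w hw
  rw [support_eq_range hσ] at hv
  obtain ⟨u, rfl⟩ := hv
  have hsum : ∑ j, inner ℂ (LinearMap.adjoint (K j) w) (σ (LinearMap.adjoint (K j) w)) = 0 := by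
    have : inner ℂ w (R w) = 0 := by rw [LinearMap.mem_ker.mp hw, inner_zero_right]
    simpa [hR, LinearMap.sum_apply, inner_sum, LinearMap.adjoint_inner_left] using this
  rw [Finset.sum_eq_zero_iff_of_nonneg (fun j _ => hσ.inner_nonneg_right _)] at hsum
  have hz := apply_eq_zero_of_inner_self_eq_zero hσ (hsum i (Finset.mem_univ i))
  rw [← LinearMap.adjoint_inner_left, ← hσ.isSymmetric, hz, inner_zero_left]

/-- The output on a pure state has range spanned by vectors `Kᵢ ψ`. This reduces a query on a mixed
state to pure inputs, the only ones entering `qMaximalFidelity`. -/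
lemma support_apply_pureState_le (E : QuantumOperation H) {σ : H →ₗ[ℂ] H} (hσ : σ.IsPositive)
    {ψ : H} (hψ : ψ ∈ support σ) : support (E (pureState ψ)) ≤ support (E σ) := by
  rw [support_eq_range (E.isPositive_apply (isPositive_pureState ψ))]
  obtain ⟨m, K, -, hE⟩ := E.exists_kraus
  rintro _ ⟨v, rfl⟩
  rw [hE σ, hE, LinearMap.sum_apply]
  refine Submodule.sum_mem _ fun i _ => ?_
  simp only [pureState, LinearMap.comp_apply, ContinuousLinearMap.coe_coe,
    InnerProductSpace.rankOne_apply, map_smul]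
  exact Submodule.smul_mem _ _ (kraus_apply_mem_support K hσ hψ i)

lemma sum_inner_kraus {m : ℕ} {K : Fin m → (H →ₗ[ℂ] H)}
    (hK : (∑ i, LinearMap.adjoint (K i) ∘ₗ K i) = LinearMap.id) (φ ψ : H) :
    ∑ i, inner ℂ (K i φ) (K i ψ) = inner ℂ φ ψ := by
  have := congrArg (inner ℂ φ) (LinearMap.congr_fun hK ψ)
  simpa [LinearMap.sum_apply, inner_sum, LinearMap.adjoint_inner_right] using this

lemma sum_norm_sq_kraus {m : ℕ} {K : Fin m → (H →ₗ[ℂ] H)}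
    (hK : (∑ i, LinearMap.adjoint (K i) ∘ₗ K i) = LinearMap.id) (φ : H) :
    ∑ i, ‖K i φ‖ ^ 2 = ‖φ‖ ^ 2 := by
  have h := sum_inner_kraus hK φ φ
  simp_rw [inner_self_eq_norm_sq_to_K] at h
  exact_mod_cast h

lemma exists_kraus_apply_ne_zero {m : ℕ} {K : Fin m → (H →ₗ[ℂ] H)}
    (hK : (∑ i, LinearMap.adjoint (K i) ∘ₗ K i) = LinearMap.id) {φ : H} (hφ : ‖φ‖ = 1) :
    ∃ i, K i φ ≠ 0 := by
  by_contra! h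
  have := sum_norm_sq_kraus hK φ
  simp [h, hφ] at this

lemma exists_unit_mem_support_apply (E : QuantumOperation H) {σ : H →ₗ[ℂ] H}
    (hσ : σ.IsPositive) {ψ : H} (hψ : ψ ∈ support σ) (h1 : ‖ψ‖ = 1) :
    ∃ φ ∈ support (E σ), ‖φ‖ = 1 := by
  obtain ⟨m, K, hK, hE⟩ := E.exists_kraus
  obtain ⟨i, hi⟩ := exists_kraus_apply_ne_zero hK h1
  refine ⟨((‖K i ψ‖ : ℂ)⁻¹) • K i ψ, Submodule.smul_mem _ _ ?_, norm_smul_inv_norm hi⟩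
  rw [hE]
  exact kraus_apply_mem_support K hσ hψ i

/-- A quantum operation does not decrease the maximal fidelity of two states. -/
lemma exists_unit_mem_support_apply_norm_inner_ge (T : QuantumOperation H) {σ₀ σ₁ : H →ₗ[ℂ] H}
    (h₀ : σ₀.IsPositive) (h₁ : σ₁.IsPositive) {φ₀ φ₁ : H} (hφ₀ : φ₀ ∈ support σ₀)
    (hφ₁ : φ₁ ∈ support σ₁) (n₀ : ‖φ₀‖ = 1) (n₁ : ‖φ₁‖ = 1) :
    ∃ χ₀ ∈ support (T σ₀), ∃ χ₁ ∈ support (T σ₁), ‖χ₀‖ = 1 ∧ ‖χ₁‖ = 1 ∧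
      ‖inner ℂ φ₀ φ₁‖ ≤ ‖inner ℂ χ₀ χ₁‖ := by
  by_cases hz : inner ℂ φ₀ φ₁ = 0
  · obtain ⟨χ₀, m₀, u₀⟩ := exists_unit_mem_support_apply T h₀ hφ₀ n₀
    obtain ⟨χ₁, m₁, u₁⟩ := exists_unit_mem_support_apply T h₁ hφ₁ n₁
    exact ⟨χ₀, m₀, χ₁, m₁, u₀, u₁, by rw [hz, norm_zero]; positivity⟩
  obtain ⟨m, K, hK, hE⟩ := T.exists_kraus
  set c := ‖inner ℂ φ₀ φ₁‖ with hc
  have hcpos : 0 < c := norm_pos_iff.mpr hz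
  have hcs : ∑ i, ‖K i φ₀‖ * ‖K i φ₁‖ ≤ 1 := by
    have h2 : ∑ i, ‖K i φ₀‖ * ‖K i φ₁‖ ≤ ∑ i, (‖K i φ₀‖ ^ 2 + ‖K i φ₁‖ ^ 2) / 2 :=
      Finset.sum_le_sum fun i _ => by nlinarith [sq_nonneg (‖K i φ₀‖ - ‖K i φ₁‖)]
    rw [← Finset.sum_div, Finset.sum_add_distrib, sum_norm_sq_kraus hK, sum_norm_sq_kraus hK,
      n₀, n₁] at h2
    linarith
  -- Averaging over `i`. Nonvanishing is required too, since a branch with `K i φ₀ = 0` meets the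
  -- inequality trivially but cannot be normalized.
  obtain ⟨i, hi, hne⟩ : ∃ i, c * (‖K i φ₀‖ * ‖K i φ₁‖) ≤ ‖inner ℂ (K i φ₀) (K i φ₁)‖ ∧
      inner ℂ (K i φ₀) (K i φ₁) ≠ 0 := by
    by_contra! hcon
    have hle : ∀ i, ‖inner ℂ (K i φ₀) (K i φ₁)‖ ≤ c * (‖K i φ₀‖ * ‖K i φ₁‖) := fun i => by
      rcases le_or_gt (c * (‖K i φ₀‖ * ‖K i φ₁‖)) ‖inner ℂ (K i φ₀) (K i φ₁)‖ with h | h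
      · rw [hcon i h, norm_zero]
        positivity
      · exact h.le
    have hsum : c ≤ ∑ i, ‖inner ℂ (K i φ₀) (K i φ₁)‖ := by
      rw [hc, ← sum_inner_kraus hK]
      exact norm_sum_le _ _
    -- One strict term yields the contradiction `c < c * ∑ i, ‖K i φ₀‖ * ‖K i φ₁‖ ≤ c`.
    obtain ⟨j, -, hj⟩ : ∃ j ∈ Finset.univ, inner ℂ (K j φ₀) (K j φ₁) ≠ 0 :=
      Finset.exists_ne_zero_of_sum_ne_zero (by rw [sum_inner_kraus hK]; exact hz)
    have hlt : ∑ i, ‖inner ℂ (K i φ₀) (K i φ₁)‖ < ∑ i, c * (‖K i φ₀‖ * ‖K i φ₁‖) := by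
      refine Finset.sum_lt_sum (fun i _ => hle i) ⟨j, Finset.mem_univ j, ?_⟩
      by_contra! h
      exact hj (hcon j h)
    rw [← Finset.mul_sum] at hlt
    nlinarith
  have k₀ : K i φ₀ ≠ 0 := fun h => hne (by rw [h, inner_zero_left])
  have k₁ : K i φ₁ ≠ 0 := fun h => hne (by rw [h, inner_zero_right])
  refine ⟨((‖K i φ₀‖ : ℂ)⁻¹) • K i φ₀, Submodule.smul_mem _ _ ?_,
    ((‖K i φ₁‖ : ℂ)⁻¹) • K i φ₁, Submodule.smul_mem _ _ ?_, norm_smul_inv_norm k₀,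
    norm_smul_inv_norm k₁, ?_⟩
  · rw [hE]
    exact kraus_apply_mem_support K h₀ hφ₀ i
  · rw [hE]
    exact kraus_apply_mem_support K h₁ hφ₁ i
  · have p₀ := norm_pos_iff.mpr k₀
    have p₁ := norm_pos_iff.mpr k₁
    rw [inner_smul_left, inner_smul_right, norm_mul, norm_mul, RCLike.norm_conj, norm_inv,
      norm_inv, Complex.norm_real, Complex.norm_real, norm_norm, norm_norm]
    calc c = ‖K i φ₀‖⁻¹ * (‖K i φ₁‖⁻¹ * (c * (‖K i φ₀‖ * ‖K i φ₁‖))) := by field_simp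
      _ ≤ _ := by gcongr

end Operations

/-! ### The angle metric on rays -/

section Angle

variable {H : Type*} [NormedAddCommGroup H] [InnerProductSpace ℂ H]

/-- The angle between the rays spanned by two unit vectors. -/
noncomputable def rayAngle (φ ψ : H) : ℝ :=
  Real.arccos ‖inner ℂ φ ψ‖

lemma rayAngle_comm (φ ψ : H) : rayAngle φ ψ = rayAngle ψ φ := by
  rw [rayAngle, rayAngle, norm_inner_symm]

lemma exists_phase_inner_eq_norm (φ ψ : H) :
    ∃ c : ℂ, ‖c‖ = 1 ∧ inner ℂ φ (c • ψ) = (‖inner ℂ φ ψ‖ : ℂ) := by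
  obtain ⟨c, hc, h⟩ := Complex.exists_norm_eq_mul_self (inner ℂ φ ψ)
  exact ⟨c, hc, by rw [inner_smul_right, h]⟩

/-- The angle between rays satisfies the triangle inequality. -/
lemma rayAngle_le_add {φ ψ χ : H} (hφ : ‖φ‖ = 1) (hψ : ‖ψ‖ = 1) (hχ : ‖χ‖ = 1) :
    rayAngle φ χ ≤ rayAngle φ ψ + rayAngle ψ χ := by
  -- The phases make both overlaps with `ψ` real and nonnegative, so those two ray angles become
  -- angles of the underlying real space.
  obtain ⟨c, hc, hcψ⟩ := exists_phase_inner_eq_norm ψ φ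
  obtain ⟨d, hd, hdψ⟩ := exists_phase_inner_eq_norm ψ χ
  let _ : InnerProductSpace ℝ H := InnerProductSpace.complexToReal
  have hre : ∀ x y : H, inner ℝ x y = (inner ℂ x y).re := fun x y => rfl
  have hφ' : ‖c • φ‖ = 1 := by rw [norm_smul, hc, hφ, one_mul]
  have hχ' : ‖d • χ‖ = 1 := by rw [norm_smul, hd, hχ, one_mul]
  have key := InnerProductGeometry.angle_le_angle_add_angle (c • φ) ψ (d • χ)
  rw [InnerProductGeometry.angle_comm (c • φ) ψ] at key
  unfold InnerProductGeometry.angle at key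
  rw [hφ', hχ', hψ, hre, hre, hre, hcψ, hdψ] at key
  simp only [mul_one, div_one, Complex.ofReal_re] at key
  rw [rayAngle_comm φ ψ]
  refine le_trans (Real.arccos_le_arccos ?_) key
  calc (inner ℂ (c • φ) (d • χ)).re ≤ ‖inner ℂ (c • φ) (d • χ)‖ := Complex.re_le_norm _
    _ = ‖inner ℂ φ χ‖ := by
      rw [inner_smul_left, inner_smul_right, norm_mul, norm_mul, RCLike.norm_conj, hc, hd,
        one_mul, one_mul]

end Angle

/-! ### Angle gained per query, and induction on the number of queries -/

section QueryBound

variable {H : Type*} [NormedAddCommGroup H] [InnerProductSpace ℂ H] [FiniteDimensional ℂ H]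

/-- A nonzero subspace contains a unit vector closest to a given vector. -/
lemma exists_unit_mem_forall_norm_inner_le (S : Submodule ℂ H) {η : H} (hη : η ∈ S)
    (h1 : ‖η‖ = 1) (ψ : H) :
    ∃ φ ∈ S, ‖φ‖ = 1 ∧ ∀ s ∈ S, ‖s‖ = 1 → ‖inner ℂ s ψ‖ ≤ ‖inner ℂ φ ψ‖ := by
  have hP : ∀ s ∈ S, inner ℂ s ψ = inner ℂ s (S.starProjection ψ) := fun s hs => by
    have := S.starProjection_inner_eq_zero ψ s hs
    rw [inner_sub_left, sub_eq_zero] at this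
    rw [← inner_conj_symm, this, inner_conj_symm]
  have hmem : S.starProjection ψ ∈ S := S.starProjection_apply_mem ψ
  set p := S.starProjection ψ
  by_cases hp : p = 0
  -- If `ψ` is orthogonal to `S`, every unit vector of `S` is optimal; otherwise the normalized
  -- projection is, by Cauchy-Schwarz.
  · refine ⟨η, hη, h1, fun s hs _ => ?_⟩
    rw [hP s hs, hp, inner_zero_right, norm_zero]
    positivity
  · refine ⟨((‖p‖ : ℂ)⁻¹) • p, S.smul_mem _ hmem, norm_smul_inv_norm hp, fun s hs hs1 => ?_⟩
    rw [hP _ (S.smul_mem _ hmem), hP s hs, inner_smul_left, inner_self_eq_norm_sq_to_K]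
    have hpos := norm_pos_iff.mpr hp
    calc ‖inner ℂ s p‖ ≤ ‖s‖ * ‖p‖ := norm_inner_le_norm _ _
      _ = ‖p‖⁻¹ * ‖p‖ ^ 2 := by rw [hs1]; field_simp
      _ = _ := by simp

lemma support_pureState_le_span (ψ : H) : support (pureState ψ) ≤ ℂ ∙ ψ := by
  rw [support_eq_range (isPositive_pureState ψ)]
  rintro _ ⟨v, rfl⟩
  exact Submodule.mem_span_singleton.mpr ⟨inner ℂ ψ v, rfl⟩

/-- The pair `(ψ, ψ)` is admissible in the infimum, which is bounded below by 0. -/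
lemma qMaximalFidelity_one_le (E : QuantumOperation H) {ψ : H} (hψ : ‖ψ‖ = 1) :
    qMaximalFidelity 1 E (identityOperation H) ≤
      maximalFidelity (E (pureState ψ)) (pureState ψ) := by
  refine csInf_le ⟨0, ?_⟩ ⟨ψ, ψ, hψ, hψ, ?_, rfl⟩
  · rintro t ⟨ψ₀, ψ₁, -, -, -, rfl⟩
    exact maximalFidelity_nonneg _ _
  · rw [inner_self_eq_norm_sq_to_K, hψ]
    simp

/-- A query moves a unit vector in the support by at most the angle `arccos F̃₁(E, I)`. -/
lemma exists_unit_mem_support_rayAngle_le (E : QuantumOperation H) {σ : H →ₗ[ℂ] H}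
    (hσ : σ.IsPositive) {ψ : H} (hψ : ψ ∈ support σ) (h1 : ‖ψ‖ = 1) :
    ∃ φ ∈ support (E σ), ‖φ‖ = 1 ∧
      rayAngle φ ψ ≤ Real.arccos (qMaximalFidelity 1 E (identityOperation H)) := by
  obtain ⟨η, hη, hη1⟩ := exists_unit_mem_support_apply E (isPositive_pureState ψ)
    (mem_support_pureState ψ) h1
  obtain ⟨φ, hφ, hφ1, hmax⟩ := exists_unit_mem_forall_norm_inner_le _ hη hη1 ψ
  refine ⟨φ, support_apply_pureState_le E hσ hψ hφ, hφ1, Real.arccos_le_arccos ?_⟩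
  refine (qMaximalFidelity_one_le E h1).trans (Real.sSup_le ?_ (norm_nonneg _))
  rintro t ⟨ψ₀, h₀, ψ₁, h₁, n₀, n₁, rfl⟩
  -- The second support is the line through `ψ`, so `ψ₁` differs from `ψ` only by a phase.
  obtain ⟨a, rfl⟩ := Submodule.mem_span_singleton.mp (support_pureState_le_span ψ h₁)
  rw [norm_smul, h1, mul_one] at n₁
  rw [inner_smul_right, norm_mul, n₁, one_mul]
  exact hmax ψ₀ h₀ n₀

/-- Querying both operations increases the angle between the two states by at most
`arccos F̃₁(E₀, I) + arccos F̃₁(E₁, I)`. -/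
lemma exists_rayAngle_apply_le (E₀ E₁ : QuantumOperation H) {σ₀ σ₁ : H →ₗ[ℂ] H}
    (h₀ : σ₀.IsPositive) (h₁ : σ₁.IsPositive) {φ₀ φ₁ : H} (hφ₀ : φ₀ ∈ support σ₀)
    (hφ₁ : φ₁ ∈ support σ₁) (n₀ : ‖φ₀‖ = 1) (n₁ : ‖φ₁‖ = 1) :
    ∃ χ₀ ∈ support (E₀ σ₀), ∃ χ₁ ∈ support (E₁ σ₁), ‖χ₀‖ = 1 ∧ ‖χ₁‖ = 1 ∧
      rayAngle χ₀ χ₁ ≤ rayAngle φ₀ φ₁ +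
        (Real.arccos (qMaximalFidelity 1 E₀ (identityOperation H)) +
          Real.arccos (qMaximalFidelity 1 E₁ (identityOperation H))) := by
  obtain ⟨χ₀, m₀, u₀, a₀⟩ := exists_unit_mem_support_rayAngle_le E₀ h₀ hφ₀ n₀
  obtain ⟨χ₁, m₁, u₁, a₁⟩ := exists_unit_mem_support_rayAngle_le E₁ h₁ hφ₁ n₁
  refine ⟨χ₀, m₀, χ₁, m₁, u₀, u₁, ?_⟩
  have t₁ := rayAngle_le_add u₀ n₀ u₁
  have t₂ := rayAngle_le_add n₀ n₁ u₁
  rw [rayAngle_comm φ₁ χ₁] at t₂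
  linarith

lemma isPositive_sequentialOutput (E : QuantumOperation H) {ρ : H →ₗ[ℂ] H} (hρ : ρ.IsPositive)
    (T : ℕ → QuantumOperation H) : ∀ N, (sequentialOutput E ρ T N).IsPositive
  | 0 => hρ
  | 1 => E.isPositive_apply hρ
  | n + 2 => E.isPositive_apply
      ((T n).isPositive_apply (isPositive_sequentialOutput E hρ T (n + 1)))

/-- After `N` queries the angle between the two output states is at most
`N (arccos F̃₁(E₀, I) + arccos F̃₁(E₁, I))`. -/
lemma exists_rayAngle_sequentialOutput_le (E₀ E₁ : QuantumOperation H) {ρ : H →ₗ[ℂ] H}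
    (hρ : IsDensityOperator ρ) (T : ℕ → QuantumOperation H) : ∀ N : ℕ,
    ∃ φ₀ ∈ support (sequentialOutput E₀ ρ T N), ∃ φ₁ ∈ support (sequentialOutput E₁ ρ T N),
      ‖φ₀‖ = 1 ∧ ‖φ₁‖ = 1 ∧ rayAngle φ₀ φ₁ ≤ N *
        (Real.arccos (qMaximalFidelity 1 E₀ (identityOperation H)) +
          Real.arccos (qMaximalFidelity 1 E₁ (identityOperation H)))
  | 0 => by
    obtain ⟨φ, hφ, n⟩ := hρ.exists_unit_mem_support
    refine ⟨φ, hφ, φ, hφ, n, n, ?_⟩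
    simp [rayAngle, inner_self_eq_norm_sq_to_K, n]
  | 1 => by
    obtain ⟨φ, hφ, n⟩ := hρ.exists_unit_mem_support
    obtain ⟨χ₀, m₀, χ₁, m₁, u₀, u₁, h⟩ := exists_rayAngle_apply_le E₀ E₁ hρ.1 hρ.1 hφ hφ n n
    refine ⟨χ₀, m₀, χ₁, m₁, u₀, u₁, h.trans_eq ?_⟩
    simp [rayAngle, inner_self_eq_norm_sq_to_K, n]
  | k + 2 => by
    obtain ⟨φ₀, hφ₀, φ₁, hφ₁, n₀, n₁, h⟩ :=
      exists_rayAngle_sequentialOutput_le E₀ E₁ hρ T (k + 1)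
    have p₀ := isPositive_sequentialOutput E₀ hρ.1 T (k + 1)
    have p₁ := isPositive_sequentialOutput E₁ hρ.1 T (k + 1)
    obtain ⟨ξ₀, x₀, ξ₁, x₁, v₀, v₁, hξ⟩ :=
      exists_unit_mem_support_apply_norm_inner_ge (T k) p₀ p₁ hφ₀ hφ₁ n₀ n₁
    obtain ⟨χ₀, m₀, χ₁, m₁, u₀, u₁, hχ⟩ := exists_rayAngle_apply_le E₀ E₁
      ((T k).isPositive_apply p₀) ((T k).isPositive_apply p₁) x₀ x₁ v₀ v₁
    refine ⟨χ₀, m₀, χ₁, m₁, u₀, u₁, hχ.trans ?_⟩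
    have hT : rayAngle ξ₀ ξ₁ ≤ rayAngle φ₀ φ₁ := Real.arccos_le_arccos hξ
    push_cast at h ⊢
    linarith

lemma SequentiallyDistinguishableIn.pi_div_two_le {E₀ E₁ : QuantumOperation H} {N : ℕ}
    (h : SequentiallyDistinguishableIn E₀ E₁ N) :
    Real.pi / 2 ≤ N * (Real.arccos (qMaximalFidelity 1 E₀ (identityOperation H)) +
      Real.arccos (qMaximalFidelity 1 E₁ (identityOperation H))) := by
  obtain ⟨ρ, T, hρ, hd⟩ := h
  obtain ⟨φ₀, hφ₀, φ₁, hφ₁, -, -, ha⟩ := exists_rayAngle_sequentialOutput_le E₀ E₁ hρ T N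
  have hz := hd.inner_eq_zero (isPositive_sequentialOutput E₀ hρ.1 T N)
    (isPositive_sequentialOutput E₁ hρ.1 T N) hφ₀ hφ₁
  rwa [rayAngle, hz, norm_zero, Real.arccos_zero] at ha

end QueryBound

end QuantumDiscrimination

theorem mainTheorem6 {H : Type*} [NormedAddCommGroup H] [InnerProductSpace ℂ H]
    [FiniteDimensional ℂ H] (E₀ E₁ : QuantumDiscrimination.QuantumOperation H)
    (hdist : QuantumDiscrimination.SequentiallyPerfectlyDistinguishable E₀ E₁) :
    0 < Real.arccos (QuantumDiscrimination.qMaximalFidelity 1 E₀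
          (QuantumDiscrimination.identityOperation H)) +
        Real.arccos (QuantumDiscrimination.qMaximalFidelity 1 E₁
          (QuantumDiscrimination.identityOperation H)) ∧
    ⌈Real.pi /
        (2 * (Real.arccos (QuantumDiscrimination.qMaximalFidelity 1 E₀
                (QuantumDiscrimination.identityOperation H)) +
              Real.arccos (QuantumDiscrimination.qMaximalFidelity 1 E₁
                (QuantumDiscrimination.identityOperation H))))⌉ ≤
      (QuantumDiscrimination.optimalSequentialQueryNumber E₀ E₁ : ℤ) := by
  -- `hdist` makes the set nonempty, so its infimum is attained rather than being the default 0.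
  have hmin : QuantumDiscrimination.SequentiallyDistinguishableIn E₀ E₁
      (QuantumDiscrimination.optimalSequentialQueryNumber E₀ E₁) := Nat.sInf_mem hdist
  have hle := hmin.pi_div_two_le
  set N := QuantumDiscrimination.optimalSequentialQueryNumber E₀ E₁
  set S := Real.arccos (QuantumDiscrimination.qMaximalFidelity 1 E₀
      (QuantumDiscrimination.identityOperation H)) +
    Real.arccos (QuantumDiscrimination.qMaximalFidelity 1 E₁
      (QuantumDiscrimination.identityOperation H))
  have hS : 0 < S :=
    pos_of_mul_pos_right (lt_of_lt_of_le (by positivity) hle) (Nat.cast_nonneg N)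
  refine ⟨hS, Int.ceil_le.mpr ?_⟩
  rw [Int.cast_natCast, div_le_iff₀ (by positivity)]
  linarith
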